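/- **Notation.** In a group write $[a,b]=a^{-1}b^{-1}ab$ and $t^g=g^{-1}tg$. For a group $G$ let $\gamma_1(G)=G$, $\gamma_{j+1}(G)=[\gamma_j(G),G]$, $G'=\gamma_2(G)$. If $G$ is a finite 3-group of nilpotency class $m-1$, then $m$ is its *nilpotency index*. Its *CF-invariant* $e$ is defined by $e+1=\min\{j\ge 3 : (\gamma_j(G):\gamma_{j+1}(G))\le 3\}$. Let $\chi_j(G)=\{g\in G : [u,g]\in\gamma_{j+2}(G)\text{ for all }u\in\gamma_j(G)\}$ and $s=\min\{2\le j\le m-1 : \chi_j(G)>G'\}$. The *defect of commutativity* $k\in\{0,1\}$ of $G$ is defined by $[\chi_s(G),\gamma_e(G)]=\gamma_{m-k}(G)$. *Annihilator.* Let $G$ be metabelian (that is, $G'$ is abelian) and $x,y\in G$. The right action of $G$ on $G'$ by $t\mapsto t^g$ extends to $\mathbb Z[G]$. Put $s_2=[y,x]$. The annihilator of $G$ with respect to $x,y$ is the ideal $$\mathfrak A=\{f\in\mathbb Z[X,Y] : s_2^{f(x-1,y-1)}=1\},$$ where $X^iY^j$ is evaluated as $(x-1)^i(y-1)^j$. *Nebelung's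 representative.* For elements $x,y$ put $s_2=t_2=[y,x]$, $s_j=[s_{j-1},x]$, $t_j=[t_{j-1},y]$ ($j\ge 3$), $\sigma_3=y^3$, $\tau_3=x^3$, $\sigma_j=[\sigma_{j-1},x]$, $\tau_j=[\tau_{j-1},y]$ ($j\ge4$). Given $m\ge 4$, $m+1\le n\le 2m-3$, $e=n-m+2$, $k\in\{0,1\}$ and integers $-1\le\alpha,\beta,\gamma,\delta,\rho\le1$, the representative $G_\rho^{m,n}(\alpha,\beta,\gamma,\delta)$ of defect $k$ is the group generated by $x,y$ with the following defining relations: 1. the commutator subgroup is abelian; 2. $s_i^3s_{i+1}^3s_{i+2}=t_i^3t_{i+1}^3t_{i+2}=\sigma_i^3\sigma_{i+1}^3\sigma_{i+2}=\tau_i^3\tau_{i+1}^3\tau_{i+2}=1$ for $i\ge3$; $s_2^3s_3^3s_4=\tau_4^{-1}$; $t_2^3t_3^3t_4=\sigma_4$; 3. $[\sigma_j,y]=[\tau_j,x]=1$ for $j\ge3$; 4. $\sigma_i=1$ for $i\ge m$; $\tau_j=1$ for $j\ge e+k+1$; 5. $\sigma_i=s_{i-2}^3$, $\tau_i=t_{i-2}^{-3}$,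 $s_i=\sigma_i^{-1}\sigma_{i+1}^{-1}$, $t_i=\tau_i\tau_{i+1}$ for $i\ge5$; 6. $[s_3,y]=[s_3\sigma_3\sigma_4,y]=[t_3,x]=[t_3\tau_3^{-1}\tau_4^{-1},x]=\sigma_{m-1}^{-\rho\delta}$; 7. $s_2^3(s_3t_3)^3s_4t_4=[s_3\sigma_3\sigma_4,x]=[t_3\tau_3^{-1}\tau_4^{-1},y]=\sigma_{m-1}^{\rho\beta}$; $\tau_{e+1}=\sigma_{m-1}^{-\rho}$; 8. $s_4\sigma_4\sigma_5=t_4\tau_4^{-1}\tau_5^{-1}=s_2^{-3}\sigma_4\tau_4^{-1}=\sigma_{m-1}^{\rho\beta}$; $s_3\sigma_3\sigma_4=\sigma_{m-2}^{\rho\beta}\sigma_{m-1}^{\gamma}\tau_e^{\delta}$; $t_3^{-1}\tau_3\tau_4=\sigma_{m-2}^{\rho\delta}\sigma_{m-1}^{\alpha}\tau_e^{\beta}$. (For $m=4$, where $\rho\beta$ or $\rho\delta$ is nonzero, read $\sigma_{2}$ as $\sigma_3$; in the groups that actually occur one has $k=0\iff\rho=0$, and $\rho=0$ for $m=4$.)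 **Theorem.** Let $G$ be a finite metabelian 3-group with $G/G'$ of type $(3,3)$, of order $3^n\ge3^5$, nilpotency index $m\ge4$ with $m+1\le n\le 2m-3$, CF-invariant $e=n-m+2$ (so $3\le e\le m-1$, and $G$ has coclass $e-1\ge 2$), and defect of commutativity $k\in\{0,1\}$. Assume that $G$ is isomorphic to the representative $G_\rho^{m,n}(\alpha,\beta,\gamma,\delta)$ of defect $k$, with $-1\le\alpha,\beta,\gamma,\delta,\rho\le1$, and let $x,y\in G$ correspond to the generators of the representative. Let $T=X^2+3X+3+3Y+Y^2$. Then the annihilator $\mathfrak A\trianglelefteq\mathbb Z[X,Y]$ of $G$ with respect to $x,y$ is given as follows. 1. If $k=0$, then $\mathfrak A=(X^{m-2},\;Y^{e-1},\;XY,\;T)$. 2. If $k=1$, $m\ge6$ and $e\ge4$, then $\mathfrak A=(X^{m-2},\;Y^{e-1}-\rho X^{m-3},\;XY-\rho\delta X^{m-3},\;T+\rho\beta X^{m-3})$. 3. If $k=1$, $m\ge6$ and $e=3$, then $\mathfrak A=(X^{m-2},\;Y^{2}-(1-\beta)\rho X^{m-3},\;XY-\rho\delta X^{m-3},\;T+\rho\beta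 X^{m-3})$. -/

import Mathlib

/-! ### Lower central series, CF-invariant, two-step centralizers, defect of commutativity -/

/-- The lower central series with the group-theoretic indexing `γ₁(G) = G`,
`γ_{j+1}(G) = [γ_j(G), G]` (Mathlib starts to count at `0`). -/
def gammaSeries (G : Type*) [Group G] (j : ℕ) : Subgroup G :=
  (⊤ : Subgroup G).lowerCentralSeries (j - 1)

/-- The index of nilpotency `m`, that is, `m - 1` is the nilpotency class. -/
noncomputable def nilpotencyIndex (G : Type*) [Group G] : ℕ :=
  Group.nilpotencyClass G + 1

/-- The CF-invariant `e` of a finite `3`-group `G`: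
`e + 1 = min {j ≥ 3 | (γ_j(G) : γ_{j+1}(G)) ≤ 3}`. -/
noncomputable def cfInvariant (G : Type*) [Group G] : ℕ :=
  sInf {j : ℕ | 3 ≤ j ∧ (gammaSeries G (j + 1)).relIndex (gammaSeries G j) ≤ 3} - 1

instance gammaSeries_normal (G : Type*) [Group G] (j : ℕ) : (gammaSeries G j).Normal := by
  unfold gammaSeries
  infer_instance

/-- The two-step centralizer `χ_j(G)`: the preimage in `G` of the centralizer of
`γ_j(G)/γ_{j+2}(G)` in `G/γ_{j+2}(G)`. -/
def twoStepCentralizer (G : Type*) [Group G] (j : ℕ) : Subgroup G :=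
  (Subgroup.centralizer
    (((gammaSeries G j).map (QuotientGroup.mk' (gammaSeries G (j + 2))) :
      Subgroup (G ⧸ gammaSeries G (j + 2))) : Set (G ⧸ gammaSeries G (j + 2)))).comap
    (QuotientGroup.mk' (gammaSeries G (j + 2)))

/-- The centralizer invariant `s = min {2 ≤ j ≤ m - 1 | χ_j(G) > G'}`. -/
noncomputable def centralizerInvariant (G : Type*) [Group G] : ℕ :=
  sInf {j : ℕ | 2 ≤ j ∧ j ≤ nilpotencyIndex G - 1 ∧ commutator G < twoStepCentralizer G j}

/-- `G` has defect of commutativity `k`: `0 ≤ k ≤ 1` and `[χ_s(G), γ_e(G)] = γ_{m-k}(G)`. -/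
def HasDefect (G : Type*) [Group G] (k : ℕ) : Prop :=
  k ≤ 1 ∧
    ⁅twoStepCentralizer G (centralizerInvariant G), gammaSeries G (cfInvariant G)⁆ =
      gammaSeries G (nilpotencyIndex G - k)

/-! ### Iterated commutators and Nebelung's presentation -/

section Words

variable {G : Type*} [Group G]

/-- The commutator `[a, b] = a⁻¹ b⁻¹ a b`. -/
def rightComm (a b : G) : G := a⁻¹ * b⁻¹ * a * b

/-- The iterated commutator `[a, b, …, b]` with `i` entries `b`. -/
def iterComm (a b : G) : ℕ → G
  | 0 => a
  | i + 1 => rightComm (iterComm a b i) b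

/-- `s₂ = [y, x]`, `s_j = [s_{j-1}, x]` (used for `j ≥ 2`). -/
def sElt (x y : G) (j : ℕ) : G := iterComm (rightComm y x) x (j - 2)

/-- `t₂ = [y, x]`, `t_j = [t_{j-1}, y]` (used for `j ≥ 2`). -/
def tElt (x y : G) (j : ℕ) : G := iterComm (rightComm y x) y (j - 2)

/-- `σ₃ = y³`, `σ_j = [σ_{j-1}, x]` (used for `j ≥ 3`). -/
def sigmaElt (x y : G) (j : ℕ) : G := iterComm (y ^ 3) x (j - 3)

/-- `τ₃ = x³`, `τ_j = [τ_{j-1}, y]` (used for `j ≥ 3`). -/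
def tauElt (x y : G) (j : ℕ) : G := iterComm (x ^ 3) y (j - 3)

/-- The defining relations `lhs = rhs` of Nebelung's representative, written for two elements
`x`, `y` of an arbitrary group. Here `m` is the index of nilpotency, `e` the CF-invariant and `k`
the defect of commutativity. The subscript `m - 2` occurs in `σ_{m-2}` with exponents that are
multiples of `ρ` only (for `m = 4` the parameter `ρ` vanishes). -/
inductive NebelungRel (m e k : ℕ) (ρ α β γ δ : ℤ) (x y : G) : G → G → Prop
  /-- the commutator subgroup is abelian -/
  | metabelian (a b : G) (ha : a ∈ commutator G) (hb : b ∈ commutator G) :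
      NebelungRel m e k ρ α β γ δ x y (a * b) (b * a)
  -- basic power relations
  | power_s (i : ℕ) (hi : 3 ≤ i) : NebelungRel m e k ρ α β γ δ x y
      (sElt x y i ^ 3 * sElt x y (i + 1) ^ 3 * sElt x y (i + 2)) 1
  | power_t (i : ℕ) (hi : 3 ≤ i) : NebelungRel m e k ρ α β γ δ x y
      (tElt x y i ^ 3 * tElt x y (i + 1) ^ 3 * tElt x y (i + 2)) 1
  | power_sigma (j : ℕ) (hj : 3 ≤ j) : NebelungRel m e k ρ α β γ δ x y
      (sigmaElt x y j ^ 3 * sigmaElt x y (j + 1) ^ 3 * sigmaElt x y (j + 2)) 1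
  | power_tau (j : ℕ) (hj : 3 ≤ j) : NebelungRel m e k ρ α β γ δ x y
      (tauElt x y j ^ 3 * tauElt x y (j + 1) ^ 3 * tauElt x y (j + 2)) 1
  -- supplementary power relations
  | suppl_s : NebelungRel m e k ρ α β γ δ x y
      (sElt x y 2 ^ 3 * sElt x y 3 ^ 3 * sElt x y 4) (tauElt x y 4)⁻¹
  | suppl_t : NebelungRel m e k ρ α β γ δ x y
      (tElt x y 2 ^ 3 * tElt x y 3 ^ 3 * tElt x y 4) (sigmaElt x y 4)
  -- commutator relations
  | comm_sigma (j : ℕ) (hj : 3 ≤ j) : NebelungRel m e k ρ α β γ δ x y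
      (rightComm (sigmaElt x y j) y) 1
  | comm_tau (j : ℕ) (hj : 3 ≤ j) : NebelungRel m e k ρ α β γ δ x y
      (rightComm (tauElt x y j) x) 1
  -- nilpotency relations
  | nilp_sigma (i : ℕ) (hi : m ≤ i) : NebelungRel m e k ρ α β γ δ x y (sigmaElt x y i) 1
  | nilp_tau (j : ℕ) (hj : e + k + 1 ≤ j) : NebelungRel m e k ρ α β γ δ x y (tauElt x y j) 1
  -- basic connecting relations
  | conn_sigma (i : ℕ) (hi : 5 ≤ i) : NebelungRel m e k ρ α β γ δ x y
      (sigmaElt x y i) (sElt x y (i - 2) ^ 3)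
  | conn_tau (i : ℕ) (hi : 5 ≤ i) : NebelungRel m e k ρ α β γ δ x y
      (tauElt x y i) (tElt x y (i - 2) ^ 3)⁻¹
  | conn_s (j : ℕ) (hj : 5 ≤ j) : NebelungRel m e k ρ α β γ δ x y
      (sElt x y j) ((sigmaElt x y j)⁻¹ * (sigmaElt x y (j + 1))⁻¹)
  | conn_t (j : ℕ) (hj : 5 ≤ j) : NebelungRel m e k ρ α β γ δ x y
      (tElt x y j) (tauElt x y j * tauElt x y (j + 1))
  -- first central relations, with value `σ_{m-1}^{-ρδ}`
  | central_s3_y : NebelungRel m e k ρ α β γ δ x y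
      (rightComm (sElt x y 3) y) (sigmaElt x y (m - 1) ^ (-(ρ * δ)))
  | central_s3_y' : NebelungRel m e k ρ α β γ δ x y
      (rightComm (sElt x y 3 * sigmaElt x y 3 * sigmaElt x y 4) y)
      (sigmaElt x y (m - 1) ^ (-(ρ * δ)))
  | central_t3_x : NebelungRel m e k ρ α β γ δ x y
      (rightComm (tElt x y 3) x) (sigmaElt x y (m - 1) ^ (-(ρ * δ)))
  | central_t3_x' : NebelungRel m e k ρ α β γ δ x y
      (rightComm (tElt x y 3 * (tauElt x y 3)⁻¹ * (tauElt x y 4)⁻¹) x)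
      (sigmaElt x y (m - 1) ^ (-(ρ * δ)))
  -- first central relations, with value `σ_{m-1}^{ρβ}`
  | central_trace : NebelungRel m e k ρ α β γ δ x y
      (sElt x y 2 ^ 3 * (sElt x y 3 * tElt x y 3) ^ 3 * sElt x y 4 * tElt x y 4)
      (sigmaElt x y (m - 1) ^ (ρ * β))
  | central_s3_x : NebelungRel m e k ρ α β γ δ x y
      (rightComm (sElt x y 3 * sigmaElt x y 3 * sigmaElt x y 4) x)
      (sigmaElt x y (m - 1) ^ (ρ * β))
  | central_t3_y : NebelungRel m e k ρ α β γ δ x y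
      (rightComm (tElt x y 3 * (tauElt x y 3)⁻¹ * (tauElt x y 4)⁻¹) y)
      (sigmaElt x y (m - 1) ^ (ρ * β))
  | central_tau : NebelungRel m e k ρ α β γ δ x y
      (tauElt x y (e + 1)) (sigmaElt x y (m - 1) ^ (-ρ))
  -- second central relations
  | second_s4 : NebelungRel m e k ρ α β γ δ x y
      (sElt x y 4 * sigmaElt x y 4 * sigmaElt x y 5) (sigmaElt x y (m - 1) ^ (ρ * β))
  | second_t4 : NebelungRel m e k ρ α β γ δ x y
      (tElt x y 4 * (tauElt x y 4)⁻¹ * (tauElt x y 5)⁻¹) (sigmaElt x y (m - 1) ^ (ρ * β))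
  | second_s2 : NebelungRel m e k ρ α β γ δ x y
      ((sElt x y 2 ^ 3)⁻¹ * sigmaElt x y 4 * (tauElt x y 4)⁻¹) (sigmaElt x y (m - 1) ^ (ρ * β))
  | second_s3 : NebelungRel m e k ρ α β γ δ x y
      (sElt x y 3 * sigmaElt x y 3 * sigmaElt x y 4)
      (sigmaElt x y (m - 2) ^ (ρ * β) * sigmaElt x y (m - 1) ^ γ * tauElt x y e ^ δ)
  | second_t3 : NebelungRel m e k ρ α β γ δ x y
      ((tElt x y 3)⁻¹ * tauElt x y 3 * tauElt x y 4)
      (sigmaElt x y (m - 2) ^ (ρ * δ) * sigmaElt x y (m - 1) ^ α * tauElt x y e ^ β)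

end Words

/-- The relators of Nebelung's representative in the free group on `x = of 0`, `y = of 1`;
the CF-invariant is `e = n - m + 2`. -/
def nebelungRelators (m n k : ℕ) (ρ α β γ δ : ℤ) : Set (FreeGroup (Fin 2)) :=
  {w | ∃ a b : FreeGroup (Fin 2),
    NebelungRel m (n - m + 2) k ρ α β γ δ (FreeGroup.of 0) (FreeGroup.of 1) a b ∧ w = a * b⁻¹}

/-- Nebelung's representative `G_ρ^{m,n}(α, β, γ, δ)` (with defect of commutativity `k`). -/
abbrev NebelungGroup (m n k : ℕ) (ρ α β γ δ : ℤ) : Type :=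
  PresentedGroup (nebelungRelators m n k ρ α β γ δ)

/-- The generators of Nebelung's representative: index `0` is `x`, index `1` is `y`. -/
def NebelungGroup.gen (m n k : ℕ) (ρ α β γ δ : ℤ) (i : Fin 2) : NebelungGroup m n k ρ α β γ δ :=
  PresentedGroup.of i

/-! ### Symbolic powers and the annihilator -/

section Annihilator

open scoped IsMulCommutative
open MvPolynomial

variable {G : Type*} [Group G]

section Action

variable [IsMulCommutative (commutator G)]

/-- The right action `t ↦ t^g = g⁻¹ t g` of `G` on `G'`, as a homomorphism into the opposite of the
endomorphism ring of the abelian group `G'` (written additively). -/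
def conjAction : G →* (AddMonoid.End (Additive (commutator G)))ᵐᵒᵖ where
  toFun g := MulOpposite.op
    (MonoidHom.toAdditive ((MulAut.conjNormal g⁻¹ : MulAut (commutator G)).toMonoidHom))
  map_one' := by
    apply MulOpposite.unop_injective
    refine AddMonoidHom.ext fun t => Additive.toMul.injective (Subtype.ext ?_)
    change ((MulAut.conjNormal (1 : G)⁻¹ t.toMul : commutator G) : G) = t.toMul
    simp
  map_mul' g h := by
    apply MulOpposite.unop_injective
    refine AddMonoidHom.ext fun t => Additive.toMul.injective (Subtype.ext ?_)
    change ((MulAut.conjNormal (g * h)⁻¹ t.toMul : commutator G) : G) =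
      (MulAut.conjNormal h⁻¹ (MulAut.conjNormal g⁻¹ t.toMul : commutator G) : commutator G)
    simp only [MulAut.conjNormal_apply]
    group

theorem conjAction_apply (g : G) (t : commutator G) :
    ((((conjAction g).unop (Additive.ofMul t)).toMul : commutator G) : G) = g⁻¹ * t * g := by
  change ((MulAut.conjNormal g⁻¹ t : commutator G) : G) = g⁻¹ * t * g
  simp

/-- The extension of the action of `G` on `G'` to the integral group ring `ℤ[G]`. -/
noncomputable def groupRingAction :
    MonoidAlgebra ℤ G →ₐ[ℤ] (AddMonoid.End (Additive (commutator G)))ᵐᵒᵖ :=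
  MonoidAlgebra.lift ℤ _ G conjAction

/-- The symbolic power `t^r` of `t ∈ G'` with exponent `r ∈ ℤ[G]`. -/
noncomputable def symbolicPower (t : commutator G) (r : MonoidAlgebra ℤ G) : commutator G :=
  (((groupRingAction r).unop (Additive.ofMul t)).toMul)

end Action

/-- The additive map `ψ : ℤ[X, Y] → ℤ[G]`, `f(X, Y) ↦ f(x - 1, y - 1)`, which sends the monomial
`X^i Y^j` to `(x - 1)^i (y - 1)^j`; here `X = X 0` and `Y = X 1`. -/
noncomputable def shiftedEval (x y : G) : MvPolynomial (Fin 2) ℤ →ₗ[ℤ] MonoidAlgebra ℤ G :=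
  (MvPolynomial.basisMonomials (Fin 2) ℤ).constr ℤ fun d =>
    (MonoidAlgebra.of ℤ G x - 1) ^ d 0 * (MonoidAlgebra.of ℤ G y - 1) ^ d 1

/-- The main commutator `s₂ = [y, x]` as an element of `G'`. -/
def mainCommutator (x y : G) : commutator G :=
  ⟨rightComm y x, by
    have h : y⁻¹ * x⁻¹ * y⁻¹⁻¹ * x⁻¹⁻¹ ∈ commutator G :=
      Subgroup.commutator_mem_commutator (Subgroup.mem_top _) (Subgroup.mem_top _)
    simpa [rightComm] using h⟩

variable [IsMulCommutative (commutator G)]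

/-- The map `Ψ : ℤ[X, Y] → G'`, `f ↦ s₂^{f(x-1, y-1)}`. -/
noncomputable def furtwaenglerMap (x y : G) (f : MvPolynomial (Fin 2) ℤ) : commutator G :=
  symbolicPower (mainCommutator x y) (shiftedEval x y f)

theorem conjAction_commute (x y : G) : Commute (conjAction x) (conjAction y) := by
  rw [commute_iff_eq, ← map_mul, ← map_mul]
  apply MulOpposite.unop_injective
  refine AddMonoidHom.ext fun t => ?_
  have h : (x * y) * (y * x)⁻¹ ∈ commutator G := by
    have h := Subgroup.commutator_mem_commutator (Subgroup.mem_top x) (Subgroup.mem_top y)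
    simpa [commutator_def, commutatorElement_def, mul_assoc] using h
  have hc : (x * y) * (y * x)⁻¹ * (t.toMul : G) = (t.toMul : G) * ((x * y) * (y * x)⁻¹) :=
    congrArg Subtype.val (mul_comm' (⟨_, h⟩ : commutator G) t.toMul)
  have h2 : (x * y)⁻¹ * (t.toMul : G) * (x * y) = (y * x)⁻¹ * (t.toMul : G) * (y * x) := by
    have h3 : (t.toMul : G) = ((x * y) * (y * x)⁻¹)⁻¹ * ((t.toMul : G) * ((x * y) * (y * x)⁻¹)) := by
      rw [← hc]; group
    calc (x * y)⁻¹ * (t.toMul : G) * (x * y)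
        = (x * y)⁻¹ * ((t.toMul : G) * ((x * y) * (y * x)⁻¹)) * (y * x) := by group
      _ = (y * x)⁻¹ * (t.toMul : G) * (y * x) := by rw [← hc]; group
  apply Additive.toMul.injective
  apply Subtype.ext
  exact (conjAction_apply (x * y) t.toMul).trans
    (h2.trans (conjAction_apply (y * x) t.toMul).symm)

theorem groupRingAction_shiftedEval_mul (x y : G) (f g : MvPolynomial (Fin 2) ℤ) :
    groupRingAction (shiftedEval x y (f * g)) =
      groupRingAction (shiftedEval x y f) * groupRingAction (shiftedEval x y g) := by
  have key : ∀ d : Fin 2 →₀ ℕ, ∀ c : ℤ, groupRingAction (shiftedEval x y (monomial d c)) =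
      c • ((conjAction x - 1) ^ d 0 * (conjAction y - 1) ^ d 1) := by
    intro d c
    have h1 : monomial d c = c • (basisMonomials (Fin 2) ℤ d) := by
      simp [smul_monomial]
    rw [h1, map_smul, map_smul, shiftedEval, Module.Basis.constr_basis]
    simp [groupRingAction]
  have hcomm : Commute (conjAction x - 1) (conjAction y - 1) :=
    ((conjAction_commute x y).sub_left (Commute.one_left _)).sub_right
      (((Commute.one_right _)).sub_left (Commute.one_right _))
  induction f using MvPolynomial.induction_on' with
  | add p q hp hq => rw [add_mul, map_add, map_add, hp, hq, map_add, map_add, add_mul]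
  | monomial d c =>
    induction g using MvPolynomial.induction_on' with
    | add p q hp hq => rw [mul_add, map_add, map_add, hp, hq, map_add, map_add, mul_add]
    | monomial d' c' =>
      rw [monomial_mul, key, key, key, smul_mul_smul_comm]
      congr 1
      rw [Finsupp.add_apply, Finsupp.add_apply, pow_add, pow_add,
        ((hcomm.pow_pow (d' 0) (d 1))).mul_mul_mul_comm]

/-- The annihilator `𝔄 = {f ∈ ℤ[X, Y] | s₂^{f(x-1, y-1)} = 1}` with respect to `x`, `y ∈ G`. -/
noncomputable def annihilatorIdeal (x y : G) : Ideal (MvPolynomial (Fin 2) ℤ) where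
  carrier := {f | furtwaenglerMap x y f = 1}
  zero_mem' := by
    change furtwaenglerMap x y 0 = 1
    simp [furtwaenglerMap, symbolicPower]
  add_mem' {f g} hf hg := by
    change furtwaenglerMap x y f = 1 at hf
    change furtwaenglerMap x y g = 1 at hg
    change furtwaenglerMap x y (f + g) = 1
    rw [furtwaenglerMap, symbolicPower] at hf hg ⊢
    rw [map_add, map_add, MulOpposite.unop_add]
    exact (congrArg₂ (· * ·) hf hg).trans (mul_one 1)
  smul_mem' c f hf := by
    change furtwaenglerMap x y f = 1 at hf
    change furtwaenglerMap x y (c * f) = 1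
    rw [furtwaenglerMap, symbolicPower, toMul_eq_one] at hf ⊢
    rw [mul_comm, groupRingAction_shiftedEval_mul, MulOpposite.unop_mul, AddMonoid.End.coe_mul,
      Function.comp_apply, hf, map_zero]

end Annihilator

/-- The trace polynomial `T = X² + 3X + 3 + 3Y + Y²`. -/
noncomputable def tracePoly : MvPolynomial (Fin 2) ℤ :=
  MvPolynomial.X 0 ^ 2 + 3 * MvPolynomial.X 0 + 3 + 3 * MvPolynomial.X 1 + MvPolynomial.X 1 ^ 2

/-! ### Transport of words and relations from the free group to `G`. -/

section WordImages

variable {G H : Type*} [Group G] [Group H]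

/-! Evaluating exponents on `s₂` gives a homomorphism Ψ from ℤ[X,Y] to `G'`, with kernel the
annihilator 𝔄. It is onto (`furtwaenglerHom_surjective`), because its image is a normal subgroup
containing [y,x] and x, y generate `G`. Hence ℤ[X,Y]/𝔄 has exactly |G'| = 3^(n-2) elements.

Let 𝔅 be the ideal proposed in the theorem. Two facts suffice: 𝔅 ⊆ 𝔄, and ℤ[X,Y]/𝔅 has at most
3^(n-2) elements. The surjection ℤ[X,Y]/𝔅 → `G'` is then bijective by counting, so 𝔅 = 𝔄
(`annihilatorIdeal_eq_span`). Only the relations of the presentation that put the generators of 𝔅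
into 𝔄 are needed; the known order of `G` replaces any proof that no further relations hold.

The inclusion is a translation: Ψ sends X^i to s_(i+2), Y^i to t_(i+2), XY to [s₃,y] and T to the
left side of the trace relation. `nebelung_relations` expresses all these values as powers of
σ_(m-1), and for m ≥ 6 one has σ_(m-1) = s_(m-1)⁻¹, the inverse of Ψ(X^(m-3)).

The bound (`finite_card_le_of_relations`) comes from the chain of ideals 0 = (x^(m-2)) ⊆ … ⊆ (x) =
(x, y^(e-1)) ⊆ … ⊆ (x, 1). There are (m-3) + (e-1) = n-2 steps, and each step multiplies the order
by at most 3. -/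

theorem map_iterComm (f : G →* H) (a b : G) (i : ℕ) :
    f (iterComm a b i) = iterComm (f a) (f b) i := by
  induction i with
  | zero => rfl
  | succ i ih => simp [iterComm, rightComm, ih]

theorem map_sElt (f : G →* H) (x y : G) (j : ℕ) : f (sElt x y j) = sElt (f x) (f y) j := by
  simp [sElt, map_iterComm, rightComm]

theorem map_tElt (f : G →* H) (x y : G) (j : ℕ) : f (tElt x y j) = tElt (f x) (f y) j := by
  simp [tElt, map_iterComm, rightComm]

theorem map_sigmaElt (f : G →* H) (x y : G) (j : ℕ) :
    f (sigmaElt x y j) = sigmaElt (f x) (f y) j := by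
  simp [sigmaElt, map_iterComm]

theorem map_tauElt (f : G →* H) (x y : G) (j : ℕ) :
    f (tauElt x y j) = tauElt (f x) (f y) j := by
  simp [tauElt, map_iterComm]

theorem map_rightComm (f : G →* H) (a b : G) : f (rightComm a b) = rightComm (f a) (f b) := by
  simp [rightComm]

/-- The homomorphism from the free group onto a group identified with Nebelung's representative. -/
def nebelungHom {m n k : ℕ} {ρ α β γ δ : ℤ} (φ : NebelungGroup m n k ρ α β γ δ ≃* G) :
    FreeGroup (Fin 2) →* G :=
  φ.toMonoidHom.comp (PresentedGroup.mk (nebelungRelators m n k ρ α β γ δ))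

theorem nebelungHom_surjective {m n k : ℕ} {ρ α β γ δ : ℤ}
    (φ : NebelungGroup m n k ρ α β γ δ ≃* G) : Function.Surjective (nebelungHom φ) :=
  φ.surjective.comp (PresentedGroup.mk_surjective _)

/-- The relator attached to a relation a = b is ab⁻¹, which dies in the presented group. This turns
every defining relation into an equation in `G`. -/
theorem nebelungHom_eq_of_rel {m n k : ℕ} {ρ α β γ δ : ℤ}
    (φ : NebelungGroup m n k ρ α β γ δ ≃* G) {a b : FreeGroup (Fin 2)}
    (h : NebelungRel m (n - m + 2) k ρ α β γ δ (FreeGroup.of 0) (FreeGroup.of 1) a b) :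
    nebelungHom φ a = nebelungHom φ b := by
  refine congrArg φ ?_
  have h1 : PresentedGroup.mk (nebelungRelators m n k ρ α β γ δ) (a * b⁻¹) = 1 :=
    PresentedGroup.one_of_mem ⟨a, b, h, rfl⟩
  rwa [map_mul, map_inv, mul_inv_eq_one] at h1

end WordImages

/-! ### The map Ψ: values on monomials and surjectivity. -/

section FurtwaenglerHom

open scoped IsMulCommutative
open MvPolynomial

variable {G : Type*} [Group G]

theorem shiftedEval_monomial_one (x y : G) (d : Fin 2 →₀ ℕ) :
    shiftedEval x y (monomial d 1) =
      (MonoidAlgebra.of ℤ G x - 1) ^ d 0 * (MonoidAlgebra.of ℤ G y - 1) ^ d 1 := by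
  have h := Module.Basis.constr_basis (MvPolynomial.basisMonomials (Fin 2) ℤ) ℤ
    (fun d => (MonoidAlgebra.of ℤ G x - 1) ^ d 0 * (MonoidAlgebra.of ℤ G y - 1) ^ d 1) d
  simpa [shiftedEval] using h

/-- A normal subgroup containing the commutator of two generators contains `G'`. -/
theorem commutator_le_of_rightComm_mem {x y : G} (hxy : Subgroup.closure {x, y} = ⊤)
    {H : Subgroup G} [H.Normal] (h : rightComm y x ∈ H) : commutator G ≤ H := by
  let q := QuotientGroup.mk' H
  have hq : q x * q y = q y * q x := by
    have h1 : q (rightComm y x) = 1 := (QuotientGroup.eq_one_iff _).2 h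
    simp only [rightComm, map_mul, map_inv] at h1
    rw [mul_assoc, ← mul_inv_rev, inv_mul_eq_one] at h1
    exact h1
  -- Generation by x, y is used twice: every image commutes with the images of x and y, so these two
  -- are central, and therefore every image is central.
  have h1 : ∀ g, q g ∈ Subgroup.centralizer {q x, q y} := by
    have : ⊤ ≤ (Subgroup.centralizer {q x, q y}).comap q := by
      rw [← hxy, Subgroup.closure_le]
      rintro g (rfl | rfl) <;>
        simp [Subgroup.mem_centralizer_iff, hq]
    exact fun g => this (Subgroup.mem_top g)
  have h2 : ∀ g, q g ∈ Subgroup.center (G ⧸ H) := by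
    have : ⊤ ≤ (Subgroup.center (G ⧸ H)).comap q := by
      rw [← hxy, Subgroup.closure_le]
      intro g hg
      refine Subgroup.mem_center_iff.2 fun z => ?_
      obtain ⟨z, rfl⟩ := QuotientGroup.mk'_surjective H z
      have h3 := Subgroup.mem_centralizer_iff.1 (h1 z)
      rcases hg with rfl | rfl
      · exact (h3 (q g) (by simp)).symm
      · exact (h3 (q g) (by simp)).symm
    exact fun g => this (Subgroup.mem_top g)
  rw [commutator_def, Subgroup.commutator_le]
  intro a _ b _
  refine (QuotientGroup.eq_one_iff _).1 ?_
  change q (a * b * a⁻¹ * b⁻¹) = 1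
  rw [map_mul, map_mul, map_mul, Subgroup.mem_center_iff.1 (h2 b) (q a), map_inv, map_inv,
    mul_inv_cancel_right, mul_inv_cancel]

variable [IsMulCommutative (commutator G)]

/-- The map `Ψ` as a homomorphism of additive groups. -/
noncomputable def furtwaenglerHom (x y : G) :
    MvPolynomial (Fin 2) ℤ →+ Additive (commutator G) where
  toFun f := Additive.ofMul (furtwaenglerMap x y f)
  map_zero' := by simp [furtwaenglerMap, symbolicPower]
  map_add' f g := by
    simp only [furtwaenglerMap, symbolicPower, map_add, MulOpposite.unop_add]
    rfl

/-- The value of `Ψ` as an element of `G`. -/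
noncomputable def furtwaenglerVal (x y : G) (f : MvPolynomial (Fin 2) ℤ) : G :=
  (furtwaenglerMap x y f : G)

theorem mem_annihilatorIdeal_iff (x y : G) (f : MvPolynomial (Fin 2) ℤ) :
    f ∈ annihilatorIdeal x y ↔ furtwaenglerVal x y f = 1 := by
  change furtwaenglerMap x y f = 1 ↔ _
  rw [furtwaenglerVal, OneMemClass.coe_eq_one]

theorem furtwaenglerVal_add (x y : G) (f g : MvPolynomial (Fin 2) ℤ) :
    furtwaenglerVal x y (f + g) = furtwaenglerVal x y f * furtwaenglerVal x y g :=
  congrArg (fun t : Additive (commutator G) => (t.toMul : G)) (map_add (furtwaenglerHom x y) f g)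

theorem furtwaenglerVal_sub (x y : G) (f g : MvPolynomial (Fin 2) ℤ) :
    furtwaenglerVal x y (f - g) = furtwaenglerVal x y f * (furtwaenglerVal x y g)⁻¹ := by
  refine (congrArg (fun t : Additive (commutator G) => (t.toMul : G))
    (map_sub (furtwaenglerHom x y) f g)).trans ?_
  rw [sub_eq_add_neg]
  rfl

theorem furtwaenglerVal_C_mul (x y : G) (c : ℤ) (f : MvPolynomial (Fin 2) ℤ) :
    furtwaenglerVal x y (C c * f) = furtwaenglerVal x y f ^ c := by
  rw [← smul_eq_C_mul]
  exact congrArg (fun t : Additive (commutator G) => (t.toMul : G))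
    (map_zsmul (furtwaenglerHom x y) c f)

theorem furtwaenglerVal_nsmul (x y : G) (c : ℕ) (f : MvPolynomial (Fin 2) ℤ) :
    furtwaenglerVal x y (c • f) = furtwaenglerVal x y f ^ c :=
  congrArg (fun t : Additive (commutator G) => (t.toMul : G))
    (map_nsmul (furtwaenglerHom x y) c f)

/-- Since t^(g-1) = t⁻¹t^g, multiplying an exponent by X or Y appends a commutator with x or y. This
is the bridge from polynomials to the iterated commutators s_j and t_j. -/
theorem symbolicPower_of_sub_one (g : G) (t : commutator G) :
    (symbolicPower t (MonoidAlgebra.of ℤ G g - 1) : G) = rightComm (t : G) g := by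
  have h1 : groupRingAction (MonoidAlgebra.of ℤ G g - 1) = conjAction g - 1 := by
    simp [groupRingAction]
  have h2 : ((conjAction g - 1).unop : AddMonoid.End (Additive (commutator G))) (Additive.ofMul t) =
      -Additive.ofMul t + (conjAction g).unop (Additive.ofMul t) := by
    rw [neg_add_eq_sub]
    rfl
  rw [symbolicPower, h1, h2]
  change (t : G)⁻¹ * (((conjAction g).unop (Additive.ofMul t)).toMul : commutator G) = _
  rw [conjAction_apply, rightComm]
  group

theorem furtwaenglerMap_mul (x y : G) (f g : MvPolynomial (Fin 2) ℤ) :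
    furtwaenglerMap x y (f * g) = symbolicPower (furtwaenglerMap x y f) (shiftedEval x y g) := by
  simp only [furtwaenglerMap, symbolicPower, groupRingAction_shiftedEval_mul, MulOpposite.unop_mul]
  rfl

theorem furtwaenglerVal_one (x y : G) : furtwaenglerVal x y 1 = rightComm y x := by
  have h : shiftedEval x y 1 = 1 := by
    simpa using shiftedEval_monomial_one x y 0
  rw [furtwaenglerVal, furtwaenglerMap, h, symbolicPower, map_one]
  rfl

theorem furtwaenglerVal_mul_X_zero (x y : G) (f : MvPolynomial (Fin 2) ℤ) :
    furtwaenglerVal x y (f * X 0) = rightComm (furtwaenglerVal x y f) x := by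
  have h : shiftedEval x y (X 0) = MonoidAlgebra.of ℤ G x - 1 := by
    simpa [X] using shiftedEval_monomial_one x y (Finsupp.single 0 1)
  rw [furtwaenglerVal, furtwaenglerMap_mul, h, symbolicPower_of_sub_one, furtwaenglerVal]

theorem furtwaenglerVal_mul_X_one (x y : G) (f : MvPolynomial (Fin 2) ℤ) :
    furtwaenglerVal x y (f * X 1) = rightComm (furtwaenglerVal x y f) y := by
  have h : shiftedEval x y (X 1) = MonoidAlgebra.of ℤ G y - 1 := by
    simpa [X] using shiftedEval_monomial_one x y (Finsupp.single 1 1)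
  rw [furtwaenglerVal, furtwaenglerMap_mul, h, symbolicPower_of_sub_one, furtwaenglerVal]

theorem furtwaenglerVal_X_zero_pow (x y : G) (i : ℕ) :
    furtwaenglerVal x y (X 0 ^ i) = sElt x y (i + 2) := by
  induction i with
  | zero => simp [furtwaenglerVal_one, sElt, iterComm]
  | succ i ih =>
    rw [pow_succ, furtwaenglerVal_mul_X_zero, ih]
    rfl

theorem furtwaenglerVal_X_one_pow (x y : G) (i : ℕ) :
    furtwaenglerVal x y (X 1 ^ i) = tElt x y (i + 2) := by
  induction i with
  | zero => simp [furtwaenglerVal_one, tElt, iterComm]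
  | succ i ih =>
    rw [pow_succ, furtwaenglerVal_mul_X_one, ih]
    rfl

theorem furtwaenglerVal_tracePoly (x y : G) :
    furtwaenglerVal x y tracePoly =
      sElt x y 2 ^ 3 * (sElt x y 3 * tElt x y 3) ^ 3 * sElt x y 4 * tElt x y 4 := by
  have h : tracePoly = 3 • (X 0 ^ 0) + 3 • (X 0 ^ 1 + X 1 ^ 1) + X 0 ^ 2 + X 1 ^ 2 := by
    rw [tracePoly]
    simp only [nsmul_eq_mul]
    push_cast
    ring
  rw [h]
  simp only [furtwaenglerVal_add, furtwaenglerVal_nsmul, furtwaenglerVal_X_zero_pow,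
    furtwaenglerVal_X_one_pow]

/-- If `x` and `y` generate `G`, then the main commutator generates `G'` as a module. -/
theorem furtwaenglerHom_surjective [Finite G] (x y : G)
    (hxy : Subgroup.closure {x, y} = ⊤) : Function.Surjective (furtwaenglerHom x y) := by
  -- The image of Ψ, viewed inside `G`.
  let H : Subgroup G :=
    { carrier := Set.range (furtwaenglerVal x y)
      one_mem' := ⟨0, by simpa using furtwaenglerVal_sub x y 0 0⟩
      mul_mem' := by
        rintro _ _ ⟨f, rfl⟩ ⟨g, rfl⟩
        exact ⟨f + g, furtwaenglerVal_add x y f g⟩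
      inv_mem' := by
        rintro _ ⟨f, rfl⟩
        refine ⟨C (-1) * f, ?_⟩
        rw [furtwaenglerVal_C_mul, zpow_neg_one] }
  have hcomm : rightComm y x ∈ H := ⟨1, furtwaenglerVal_one x y⟩
  have hconj : ∀ g ∈ ({x, y} : Set G), ∀ t ∈ H, g⁻¹ * t * g ∈ H := by
    have key : ∀ g t : G, t ∈ H → rightComm t g ∈ H → g⁻¹ * t * g ∈ H := by
      intro g t ht h
      have : g⁻¹ * t * g = t * rightComm t g := by rw [rightComm]; group
      rw [this]
      exact H.mul_mem ht h
    rintro g (rfl | rfl) _ ⟨f, rfl⟩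
    · exact key _ _ ⟨f, rfl⟩ ⟨f * X 0, furtwaenglerVal_mul_X_zero _ _ f⟩
    · exact key _ _ ⟨f, rfl⟩ ⟨f * X 1, furtwaenglerVal_mul_X_one _ _ f⟩
  have hnorm : H.Normal := by
    rw [← Subgroup.normalizer_eq_top_iff, eq_top_iff, ← hxy, Subgroup.closure_le]
    intro g hg
    -- As H is finite, being mapped into itself by conjugation is enough to lie in the normalizer.
    have h1 : g⁻¹ ∈ Subgroup.normalizer (H : Set G) := by
      have : Finite (H : Set G) := inferInstanceAs (Finite H)
      exact Subgroup.mem_normalizer_fintype fun t ht => by simpa using hconj g hg t ht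
    simpa using inv_mem h1
  have hle : commutator G ≤ H := commutator_le_of_rightComm_mem hxy hcomm
  intro t
  obtain ⟨f, hf⟩ := hle t.toMul.2
  exact ⟨f, Additive.toMul.injective (Subtype.ext hf)⟩

end FurtwaenglerHom

/-! ### Upper bound for the order of the quotient ring. -/

section QuotientBound

/-- Adjoining to an ideal an element which is annihilated modulo the ideal by `3` and by the
generators of the ring multiplies the cardinality at most by `3`. -/
theorem finite_card_sup_span_singleton_le {R : Type*} [CommRing R]
    (π : MvPolynomial (Fin 2) ℤ →+* R) (hπ : Function.Surjective π) {I J : Ideal R} {g : R} {N : ℕ}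
    (hI : I ≤ J ⊔ Ideal.span {g}) (h3 : 3 * g ∈ J) (hX : π (MvPolynomial.X 0) * g ∈ J)
    (hY : π (MvPolynomial.X 1) * g ∈ J) (hJ : Finite J ∧ Nat.card J ≤ 3 ^ N) :
    Finite I ∧ Nat.card I ≤ 3 ^ (N + 1) := by
  obtain ⟨hfin, hcard⟩ := hJ
  -- X and Y kill g modulo J, so a polynomial acts on g through its constant term. As 3 kills g too,
  -- only the residues 0, 1, 2 matter.
  have hconst : ∀ f : MvPolynomial (Fin 2) ℤ, ∃ c : ℤ, (π f - c) * g ∈ J := by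
    intro f
    induction f using MvPolynomial.induction_on with
    | C a =>
      refine ⟨a, ?_⟩
      simp
    | add p q hp hq =>
      obtain ⟨c, hc⟩ := hp
      obtain ⟨d, hd⟩ := hq
      refine ⟨c + d, ?_⟩
      have := J.add_mem hc hd
      rw [map_add]
      push_cast
      convert this using 1
      ring
    | mul_X p i _ =>
      refine ⟨0, ?_⟩
      have : π (MvPolynomial.X i) * g ∈ J := by
        fin_cases i
        · exact hX
        · exact hY
      rw [map_mul, Int.cast_zero, sub_zero, mul_assoc]
      exact J.mul_mem_left _ this
  let F : Fin 3 × J → R := fun p => p.2 + ((p.1 : ℕ) : R) * g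
  have hF : (I : Set R) ⊆ Set.range F := by
    intro r hr
    obtain ⟨j, hj, z, hz, rfl⟩ := Submodule.mem_sup.1 (hI hr)
    obtain ⟨w, rfl⟩ := Ideal.mem_span_singleton'.1 hz
    obtain ⟨f, rfl⟩ := hπ w
    obtain ⟨c, hc⟩ := hconst f
    have hmod : ((c % 3).toNat : ℤ) = c % 3 := Int.toNat_of_nonneg (Int.emod_nonneg c (by norm_num))
    have hlt : c % 3 < 3 := Int.emod_lt_of_pos c (by norm_num)
    have hc2 : (c : R) = (((c % 3).toNat : ℕ) : R) + 3 * ((c / 3 : ℤ) : R) := by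
      have h : c = ((c % 3).toNat : ℤ) + 3 * (c / 3) := by omega
      calc (c : R) = ((((c % 3).toNat : ℤ) + 3 * (c / 3) : ℤ) : R) := by rw [← h]
        _ = _ := by push_cast; ring
    have hmem : j + (π f - c) * g + ((c / 3 : ℤ) : R) * (3 * g) ∈ J :=
      J.add_mem (J.add_mem hj hc) (J.mul_mem_left _ h3)
    refine ⟨(⟨(c % 3).toNat, by omega⟩, ⟨_, hmem⟩), ?_⟩
    simp only [F]
    rw [hc2]
    ring
  have hfinR : (Set.range F).Finite := Set.finite_range F
  refine ⟨hfinR.subset hF, ?_⟩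
  calc Nat.card I ≤ Nat.card (Set.range F) := Nat.card_mono hfinR hF
    _ ≤ Nat.card (Fin 3 × J) := Finite.card_range_le F
    _ = 3 * Nat.card J := by simp [Nat.card_prod]
    _ ≤ 3 ^ (N + 1) := by rw [pow_succ]; omega

/-- Climbing the chain of ideals, the new generator g is killed by x and y modulo the previous
ideal. The trace relation writes 3 as an element of the ideal (x, y), so 3g falls into the previous
ideal as well. -/
theorem finite_card_le_of_relations {R : Type*} [CommRing R]
    (π : MvPolynomial (Fin 2) ℤ →+* R) (hπ : Function.Surjective π) {x y : R}
    (hx : π (MvPolynomial.X 0) = x) (hy : π (MvPolynomial.X 1) = y) (u v : ℕ) (a b c : R)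
    (hb : b = 0 ∨ 1 ≤ u) (h1 : x ^ (u + 2) = 0) (h2 : y ^ v = a * x ^ (u + 1))
    (h3 : x * y = b * x ^ (u + 1))
    (h4 : x ^ 2 + 3 * x + 3 + 3 * y + y ^ 2 + c * x ^ (u + 1) = 0) :
    Finite R ∧ Nat.card R ≤ 3 ^ (u + 1 + v) := by
  -- This is the purpose of `hb`: with u = 0 and b nonzero, xy would only be a multiple of x, and y
  -- would not push x^(j+1) into the next power.
  obtain ⟨b', hb'⟩ : ∃ b', x * y = b' * x ^ 2 := by
    rcases hb with rfl | hu
    · exact ⟨0, by rw [h3]; ring⟩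
    · obtain ⟨w, rfl⟩ := Nat.exists_eq_add_of_le hu
      exact ⟨b * x ^ w, by rw [h3]; ring⟩
  have hpow : ∀ i ≤ u + 1, Finite (Ideal.span {x ^ (u + 2 - i)}) ∧
      Nat.card (Ideal.span {x ^ (u + 2 - i)}) ≤ 3 ^ i := by
    intro i
    induction i with
    | zero =>
      intro _
      have : Ideal.span {x ^ (u + 2 - 0)} = (⊥ : Ideal R) := by simp [h1]
      rw [this]
      exact ⟨inferInstance, by simp⟩
    | succ i ih =>
      intro hi
      obtain ⟨j, hj⟩ : ∃ j, u + 2 - (i + 1) = j + 1 := ⟨u - i, by omega⟩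
      have hj' : u + 2 - i = j + 2 := by omega
      have ih := ih (by omega)
      rw [hj'] at ih
      rw [hj]
      have hyj : y * x ^ (j + 1) = b' * x ^ (j + 2) := by
        linear_combination x ^ j * hb'
      refine finite_card_sup_span_singleton_le π hπ (g := x ^ (j + 1)) le_sup_right ?_ ?_ ?_ ih
      -- The witness is read off from x^(j+1) times the trace relation, with yx^(j+1) replaced by
      -- b'x^(j+2).
      · refine Ideal.mem_span_singleton'.2
          ⟨-(x + 3 + 3 * b' + b' * y + c * x ^ u), ?_⟩
        linear_combination (3 + y) * hyj - x ^ (j + 1) * h4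
      · exact Ideal.mem_span_singleton'.2 ⟨1, by rw [hx]; ring⟩
      · exact Ideal.mem_span_singleton'.2 ⟨b', by rw [hy, hyj]⟩
  have hmix : ∀ i ≤ v, Finite (Ideal.span {x, y ^ (v - i)}) ∧
      Nat.card (Ideal.span {x, y ^ (v - i)}) ≤ 3 ^ (u + 1 + i) := by
    intro i
    induction i with
    | zero =>
      intro _
      -- The two halves of the chain meet at (x), because y^v is a multiple of x^(u+1).
      have h : Ideal.span {x, y ^ (v - 0)} = Ideal.span {x ^ (u + 2 - (u + 1))} := by
        have : u + 2 - (u + 1) = 1 := by omega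
        rw [this, pow_one, Nat.sub_zero]
        refine le_antisymm (Ideal.span_le.2 ?_) (Ideal.span_mono (by simp))
        rintro z (rfl | rfl)
        · exact Ideal.mem_span_singleton_self _
        · exact Ideal.mem_span_singleton'.2 ⟨a * x ^ u, by rw [h2]; ring⟩
      rw [h]
      exact hpow _ le_rfl
    | succ i ih =>
      intro hi
      obtain ⟨j, hj⟩ : ∃ j, v - (i + 1) = j := ⟨_, rfl⟩
      have hj' : v - i = j + 1 := by omega
      have ih := ih (by omega)
      rw [hj'] at ih
      rw [hj]
      refine finite_card_sup_span_singleton_le π hπ (g := y ^ j) (N := u + 1 + i) ?_ ?_ ?_ ?_ ih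
      · refine Ideal.span_le.2 ?_
        rintro z (rfl | rfl)
        · exact Ideal.mem_sup_left (Ideal.subset_span (by simp))
        · exact Ideal.mem_sup_right (Ideal.mem_span_singleton_self _)
      -- The coefficients come from solving y^j times the trace relation for 3y^j.
      · refine Ideal.mem_span_pair.2
          ⟨-(x + 3 + c * x ^ u) * y ^ j, -(3 + y), ?_⟩
        linear_combination -y ^ j * h4
      · exact Ideal.mem_span_pair.2 ⟨y ^ j, 0, by rw [hx]; ring⟩
      · exact Ideal.mem_span_pair.2 ⟨0, 1, by rw [hy]; ring⟩
  have htop : Ideal.span {x, y ^ (v - v)} = (⊤ : Ideal R) := by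
    rw [Ideal.eq_top_iff_one]
    exact Ideal.subset_span (by simp)
  have h := hmix v le_rfl
  rw [htop] at h
  obtain ⟨hf, hc⟩ := h
  let E : (⊤ : Ideal R) ≃ R := (Submodule.topEquiv (R := R) (M := R)).toEquiv
  exact ⟨Finite.of_equiv _ E, by rwa [← Nat.card_congr E]⟩

end QuotientBound

/-! ### From the order bound to equality of ideals. -/

section Annihilator

open scoped IsMulCommutative
open MvPolynomial

variable {G : Type*} [Group G] [IsMulCommutative (commutator G)]

/-- An ideal of the given shape which annihilates the main commutator is the full annihilator,
because its index is at most the order of `G'`. -/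
theorem annihilatorIdeal_eq_span [Finite G] (x y : G) (hxy : Subgroup.closure {x, y} = ⊤)
    (u v : ℕ) (hG : Nat.card (commutator G) = 3 ^ (u + 1 + v)) (a b c : ℤ) (hb : b = 0 ∨ 1 ≤ u)
    (h1 : X 0 ^ (u + 2) ∈ annihilatorIdeal x y)
    (h2 : X 1 ^ v - C a * X 0 ^ (u + 1) ∈ annihilatorIdeal x y)
    (h3 : X 0 * X 1 - C b * X 0 ^ (u + 1) ∈ annihilatorIdeal x y)
    (h4 : tracePoly + C c * X 0 ^ (u + 1) ∈ annihilatorIdeal x y) :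
    annihilatorIdeal x y = Ideal.span {X 0 ^ (u + 2), X 1 ^ v - C a * X 0 ^ (u + 1),
      X 0 * X 1 - C b * X 0 ^ (u + 1), tracePoly + C c * X 0 ^ (u + 1)} := by
  set B : Ideal (MvPolynomial (Fin 2) ℤ) := Ideal.span {X 0 ^ (u + 2),
    X 1 ^ v - C a * X 0 ^ (u + 1), X 0 * X 1 - C b * X 0 ^ (u + 1),
    tracePoly + C c * X 0 ^ (u + 1)} with hB
  have hBA : B ≤ annihilatorIdeal x y := by
    rw [hB, Ideal.span_le]
    rintro f (rfl | rfl | rfl | rfl) <;> assumption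
  refine le_antisymm ?_ hBA
  let π := Ideal.Quotient.mk B
  have hzero : ∀ f ∈ ({X 0 ^ (u + 2), X 1 ^ v - C a * X 0 ^ (u + 1),
      X 0 * X 1 - C b * X 0 ^ (u + 1), tracePoly + C c * X 0 ^ (u + 1)} :
      Set (MvPolynomial (Fin 2) ℤ)), π f = 0 :=
    fun f hf => Ideal.Quotient.eq_zero_iff_mem.2 (Ideal.subset_span hf)
  have e1 := hzero (X 0 ^ (u + 2)) (by simp)
  have e2 := hzero (X 1 ^ v - C a * X 0 ^ (u + 1)) (by simp)
  have e3 := hzero (X 0 * X 1 - C b * X 0 ^ (u + 1)) (by simp)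
  have e4 := hzero (tracePoly + C c * X 0 ^ (u + 1)) (by simp)
  simp only [tracePoly, map_sub, map_add, map_mul, map_pow, map_ofNat, sub_eq_zero] at e1 e2 e3 e4
  obtain ⟨hfin, hcard⟩ := finite_card_le_of_relations π Ideal.Quotient.mk_surjective rfl rfl u v
    (π (C a)) (π (C b)) (π (C c)) (hb.imp_left fun h => by simp [h]) e1 e2 e3 e4
  have hle : B.toAddSubgroup ≤ (furtwaenglerHom x y).ker := by
    intro f hf
    exact hBA hf
  let L : (MvPolynomial (Fin 2) ℤ ⧸ B) →+ Additive (commutator G) :=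
    QuotientAddGroup.lift B.toAddSubgroup (furtwaenglerHom x y) hle
  have hL : Function.Surjective L := by
    intro t
    obtain ⟨f, hf⟩ := furtwaenglerHom_surjective x y hxy t
    exact ⟨π f, hf⟩
  have hcardG : Nat.card (Additive (commutator G)) = 3 ^ (u + 1 + v) := hG
  -- A surjection from a finite set with at most as many elements as its target is injective; hence
  -- an annihilating polynomial is already zero modulo B.
  have hbij : Function.Bijective L := hL.bijective_of_nat_card_le (by rw [hcardG]; exact hcard)
  intro f hf
  refine Ideal.Quotient.eq_zero_iff_mem.1 (hbij.1 ?_)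
  rw [map_zero]
  exact hf

end Annihilator

/-! ### What the presentation says about s_j, t_j and σ_(m-1). -/

section Nebelung

open scoped IsMulCommutative

variable {G : Type*} [Group G]

theorem card_commutator_of_abelianization [Finite G]
    (hab : Nonempty (Abelianization G ≃* Multiplicative (ZMod 3 × ZMod 3))) {n : ℕ} (hn : 2 ≤ n)
    (hcard : Nat.card G = 3 ^ n) : Nat.card (commutator G) = 3 ^ (n - 2) := by
  obtain ⟨f⟩ := hab
  have h1 : Nat.card (G ⧸ commutator G) = 9 := by
    refine (Nat.card_congr f.toEquiv).trans ?_
    simp [Nat.card_eq_fintype_card, ZMod.card]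
  have h2 := Subgroup.card_eq_card_quotient_mul_card_subgroup (commutator G)
  obtain ⟨r, rfl⟩ := Nat.exists_eq_add_of_le hn
  rw [hcard, h1, pow_add] at h2
  rw [Nat.add_sub_cancel_left]
  omega

/-- The consequences of Nebelung's relations for the iterated commutators of `x` and `y` which
determine the annihilator. -/
theorem nebelung_relations {m n k : ℕ} {ρ α β γ δ : ℤ} (φ : NebelungGroup m n k ρ α β γ δ ≃* G)
    {x y : G} (hx : x = φ (NebelungGroup.gen m n k ρ α β γ δ 0))
    (hy : y = φ (NebelungGroup.gen m n k ρ α β γ δ 1)) (hk : k ≤ 1) (he : 3 ≤ n - m + 2) :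
    (sElt x y 2 ^ 3 * (sElt x y 3 * tElt x y 3) ^ 3 * sElt x y 4 * tElt x y 4 =
      sigmaElt x y (m - 1) ^ (ρ * β)) ∧
    (rightComm (sElt x y 3) y = sigmaElt x y (m - 1) ^ (-(ρ * δ))) ∧
    (5 ≤ m → sElt x y m = 1) ∧
    (6 ≤ m → sElt x y (m - 1) = (sigmaElt x y (m - 1))⁻¹) ∧
    (m = 4 → sElt x y 4 = sigmaElt x y (m - 1) ^ (ρ * β)) ∧
    (4 ≤ n - m + 2 → tElt x y (n - m + 3) = sigmaElt x y (m - 1) ^ (-ρ)) ∧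
    (n - m + 2 = 3 → tElt x y 4 = sigmaElt x y (m - 1) ^ ((β - 1) * ρ)) ∧
    (k = 0 → sigmaElt x y (m - 1) ^ ρ = 1) := by
  have h0 : nebelungHom φ (FreeGroup.of 0) = x := hx.symm
  have h1 : nebelungHom φ (FreeGroup.of 1) = y := hy.symm
  have hsigma : ∀ i, m ≤ i → sigmaElt x y i = 1 := fun i hi => by
    simpa [map_sigmaElt, h0, h1] using nebelungHom_eq_of_rel φ (.nilp_sigma i hi)
  have htau : ∀ i, n - m + 2 + k + 1 ≤ i → tauElt x y i = 1 := fun i hi => by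
    simpa [map_tauElt, h0, h1] using nebelungHom_eq_of_rel φ (.nilp_tau i hi)
  have hs : ∀ i, 5 ≤ i → sElt x y i = (sigmaElt x y i)⁻¹ * (sigmaElt x y (i + 1))⁻¹ :=
    fun i hi => by
      simpa only [map_mul, map_inv, map_sigmaElt, map_sElt, h0, h1]
        using nebelungHom_eq_of_rel φ (.conn_s i hi)
  have ht : ∀ i, 5 ≤ i → tElt x y i = tauElt x y i * tauElt x y (i + 1) :=
    fun i hi => by
      simpa only [map_mul, map_tauElt, map_tElt, h0, h1]
        using nebelungHom_eq_of_rel φ (.conn_t i hi)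
  have htaue : tauElt x y (n - m + 3) = sigmaElt x y (m - 1) ^ (-ρ) := by
    simpa only [map_zpow, map_tauElt, map_sigmaElt, h0, h1]
      using nebelungHom_eq_of_rel φ .central_tau
  refine ⟨?_, ?_, ?_, ?_, ?_, ?_, ?_, ?_⟩
  · simpa only [map_mul, map_pow, map_zpow, map_sElt, map_tElt, map_sigmaElt, h0, h1]
      using nebelungHom_eq_of_rel φ .central_trace
  · simpa only [map_zpow, map_sElt, map_rightComm, map_sigmaElt, h0, h1]
      using nebelungHom_eq_of_rel φ .central_s3_y
  · intro h
    rw [hs m h, hsigma m le_rfl, hsigma (m + 1) (by omega)]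
    simp
  · intro h
    rw [hs (m - 1) (by omega), hsigma (m - 1 + 1) (by omega)]
    simp
  -- The formula for s_j through the σ's starts at j = 5, so s₄ must come from a second central
  -- relation, where σ₄ = σ₅ = 1 because m = 4.
  · rintro rfl
    have := nebelungHom_eq_of_rel φ .second_s4
    simpa only [map_mul, map_zpow, map_sElt, map_sigmaElt, h0, h1, hsigma 4 le_rfl,
      hsigma 5 (by omega), mul_one] using this
  -- Here t_(e+1) = τ_(e+1)τ_(e+2), and τ_(e+2) vanishes because k ≤ 1.
  · intro h
    rw [ht _ (by omega), htaue, htau _ (by omega), mul_one]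
  -- For e = 3 the index e+1 = 4 is again too small for the connecting relation. The second central
  -- relation for t₄ contributes an extra σ_(m-1)^(ρβ), the origin of the factor 1-β in the third
  -- case.
  · intro h
    have := nebelungHom_eq_of_rel φ .second_t4
    simp only [map_mul, map_inv, map_zpow, map_tElt, map_tauElt, map_sigmaElt, h0, h1] at this
    have h4 : tauElt x y 4 = sigmaElt x y (m - 1) ^ (-ρ) := by
      rw [← htaue]
      congr 1
      omega
    rw [htau 5 (by omega), inv_one, mul_one, mul_inv_eq_iff_eq_mul, h4, ← zpow_add] at this
    rw [this]
    congr 1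
    ring
  -- For k = 0 the nilpotency relations already kill τ_(e+1), which also equals σ_(m-1)^(-ρ).
  · rintro rfl
    rw [htau _ (by omega)] at htaue
    rw [← inv_eq_one, ← zpow_neg, ← htaue]

theorem closure_nebelung_generators {m n k : ℕ} {ρ α β γ δ : ℤ}
    (φ : NebelungGroup m n k ρ α β γ δ ≃* G)
    {x y : G} (hx : x = φ (NebelungGroup.gen m n k ρ α β γ δ 0))
    (hy : y = φ (NebelungGroup.gen m n k ρ α β γ δ 1)) : Subgroup.closure {x, y} = ⊤ := by
  have h0 : nebelungHom φ (FreeGroup.of 0) = x := hx.symm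
  have h1 : nebelungHom φ (FreeGroup.of 1) = y := hy.symm
  have h2 : ({x, y} : Set G) = nebelungHom φ '' Set.range FreeGroup.of := by
    rw [← Set.range_comp]
    ext z
    simp [Fin.exists_fin_two, h0, h1, eq_comm]
  rw [h2, ← MonoidHom.map_closure, FreeGroup.closure_range_of, ← MonoidHom.range_eq_map,
    MonoidHom.range_eq_top.2 (nebelungHom_surjective φ)]

end Nebelung

/-! ### The three cases of the theorem. -/

open MvPolynomial in
theorem mainTheorem1 {G : Type*} [Group G] [Finite G]
    -- `G` is metabelian, with `G/G'` of type `(3,3)`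
    [IsMulCommutative (commutator G)]
    (hab : Nonempty (Abelianization G ≃* Multiplicative (ZMod 3 × ZMod 3)))
    -- order, index of nilpotency, CF-invariant and defect of commutativity
    (m n e k : ℕ)
    (hcard : Nat.card G = 3 ^ n) (hn5 : 5 ≤ n)
    (hm : nilpotencyIndex G = m) (hm4 : 4 ≤ m)
    (hmn : m + 1 ≤ n) (hnm : n ≤ 2 * m - 3)
    (hcf : cfInvariant G = e) (he : e = n - m + 2)
    (hk : HasDefect G k)
    -- `G` is isomorphic to the representative `G_ρ^{m,n}(α,β,γ,δ)`
    (ρ α β γ δ : ℤ)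
    (hρ : ρ ∈ Set.Icc (-1) 1) (hα : α ∈ Set.Icc (-1) 1) (hβ : β ∈ Set.Icc (-1) 1)
    (hγ : γ ∈ Set.Icc (-1) 1) (hδ : δ ∈ Set.Icc (-1) 1)
    (φ : NebelungGroup m n k ρ α β γ δ ≃* G)
    -- the generators `x`, `y` of `G` that correspond to those of the representative
    (x y : G)
    (hx : x = φ (NebelungGroup.gen m n k ρ α β γ δ 0))
    (hy : y = φ (NebelungGroup.gen m n k ρ α β γ δ 1)) :
    (k = 0 →
      annihilatorIdeal x y =
        Ideal.span {X 0 ^ (m - 2), X 1 ^ (e - 1), X 0 * X 1, tracePoly}) ∧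
    (k = 1 → 6 ≤ m → 4 ≤ e →
      annihilatorIdeal x y =
        Ideal.span {X 0 ^ (m - 2),
          X 1 ^ (e - 1) - C ρ * X 0 ^ (m - 3),
          X 0 * X 1 - C (ρ * δ) * X 0 ^ (m - 3),
          tracePoly + C (ρ * β) * X 0 ^ (m - 3)}) ∧
    (k = 1 → 6 ≤ m → e = 3 →
      annihilatorIdeal x y =
        Ideal.span {X 0 ^ (m - 2),
          X 1 ^ 2 - C ((1 - β) * ρ) * X 0 ^ (m - 3),
          X 0 * X 1 - C (ρ * δ) * X 0 ^ (m - 3),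
          tracePoly + C (ρ * β) * X 0 ^ (m - 3)}) := by
  have hcomm := card_commutator_of_abelianization hab (by omega) hcard
  have hgen := closure_nebelung_generators φ hx hy
  obtain ⟨htr, hs3, hs5, hs6, hs4, ht5, ht4, hk0⟩ :=
    nebelung_relations φ hx hy hk.1 (by omega)
  -- Shifting m and e removes truncated subtraction; then n - 2 = (m-3) + (e-1) = (u+1) + (v+2).
  obtain ⟨u, rfl⟩ : ∃ u, m = u + 4 := ⟨m - 4, by omega⟩
  obtain ⟨v, rfl⟩ : ∃ v, e = v + 3 := ⟨e - 3, by omega⟩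
  have hG : Nat.card (commutator G) = 3 ^ (u + 1 + (v + 2)) := by
    rw [hcomm]
    congr 1
    omega
  rw [show u + 4 - 1 = u + 3 by omega] at htr hs3 hs6 hs4 ht5 ht4 hk0
  rw [show n - (u + 4) + 3 = v + 4 by omega] at ht5
  rw [← he] at ht5 ht4
  have hXY : furtwaenglerVal x y (X 0 * X 1) = sigmaElt x y (u + 3) ^ (-(ρ * δ)) := by
    rw [furtwaenglerVal_mul_X_one, ← pow_one (X 0), furtwaenglerVal_X_zero_pow, hs3]
  rw [show u + 4 - 2 = u + 2 by omega, show u + 4 - 3 = u + 1 by omega,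
    show v + 3 - 1 = v + 2 by omega]
  -- The two cases with k = 1 differ only in the exponent of t_(e+1). The condition 2 ≤ u, that is m
  -- ≥ 6, makes s_(m-1) equal to σ_(m-1)⁻¹, which turns σ_(m-1)^(-a) into Ψ(aX^(m-3)).
  have hdefect : ∀ a : ℤ, 2 ≤ u → tElt x y (v + 4) = sigmaElt x y (u + 3) ^ (-a) →
      annihilatorIdeal x y = Ideal.span {X 0 ^ (u + 2), X 1 ^ (v + 2) - C a * X 0 ^ (u + 1),
        X 0 * X 1 - C (ρ * δ) * X 0 ^ (u + 1), tracePoly + C (ρ * β) * X 0 ^ (u + 1)} := by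
    intro a hu ha
    have hs := hs6 (by omega)
    refine annihilatorIdeal_eq_span x y hgen u (v + 2) hG a (ρ * δ) (ρ * β)
      (Or.inr (by omega)) ?_ ?_ ?_ ?_ <;> rw [mem_annihilatorIdeal_iff]
    · rw [furtwaenglerVal_X_zero_pow, hs5 (by omega)]
    · rw [furtwaenglerVal_sub, furtwaenglerVal_C_mul, furtwaenglerVal_X_zero_pow,
        furtwaenglerVal_X_one_pow, ha, hs, inv_zpow', mul_inv_cancel]
    · rw [furtwaenglerVal_sub, furtwaenglerVal_C_mul, furtwaenglerVal_X_zero_pow, hXY, hs,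
        inv_zpow', mul_inv_cancel]
    · rw [furtwaenglerVal_add, furtwaenglerVal_C_mul, furtwaenglerVal_X_zero_pow,
        furtwaenglerVal_tracePoly, htr, hs, inv_zpow, mul_inv_cancel]
  refine ⟨fun hk => ?_, fun _ hm6 he4 => hdefect ρ (by omega) (ht5 he4), fun _ hm6 he3 => ?_⟩
  -- For k = 0 every correction term is a power of σ_(m-1)^ρ = 1, so small m and e need no
  -- exception.
  · have hz : ∀ c : ℤ, sigmaElt x y (u + 3) ^ (ρ * c) = 1 := fun c => by
      rw [zpow_mul, hk0 hk, one_zpow]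
    have hs : sElt x y (u + 4) = 1 := by
      rcases Nat.eq_zero_or_pos u with rfl | hu
      · rw [hs4 rfl, hz]
      · exact hs5 (by omega)
    have ht : tElt x y (v + 4) = 1 := by
      rcases Nat.eq_zero_or_pos v with rfl | hv
      · rw [ht4 rfl, mul_comm, hz]
      · rw [ht5 (by omega), zpow_neg, hk0 hk, inv_one]
    have h := annihilatorIdeal_eq_span x y hgen u (v + 2) hG 0 0 0 (Or.inl rfl)
    simp only [C_0, zero_mul, sub_zero, add_zero, mem_annihilatorIdeal_iff] at h
    refine h ?_ ?_ ?_ ?_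
    · rw [furtwaenglerVal_X_zero_pow, hs]
    · rw [furtwaenglerVal_X_one_pow, ht]
    · rw [hXY, zpow_neg, hz, inv_one]
    · rw [furtwaenglerVal_tracePoly, htr, hz]
  · obtain rfl : v = 0 := by omega
    refine hdefect _ (by omega) ((ht4 rfl).trans ?_)
    congr 1
    ring
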